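/- Let $K\ge 1$ and $[K]=\{1,\dots,K\}$, and let $\boldsymbol\mu=(\mu^{(i)})_{i\in[K]}$ be a family of probability distributions on $\mathbb{Z}_+^K$. Write $$\phi^{(i)}(x)=\sum_{k\in\mathbb{Z}_+^K}\mu^{(i)}(k)\,x_1^{k_1}\cdots x_K^{k_K}$$ for the generating function of $\mu^{(i)}$, and $M=(m_{i,j})_{i,j\in[K]}$ with $m_{i,j}=\sum_{k\in\mathbb{Z}_+^K}k_j\,\mu^{(i)}(k)$ for the mean matrix. Assume that $\boldsymbol\mu$ is - entire: for every $i$, the series $\phi^{(i)}$ converges on all of $\mathbb{C}^K$ and defines an entire function; - finite: there is a family $\boldsymbol\zeta=(\zeta^{(i)})_{i\in[K]}$ of probability distributions on the finite words over $[K]$ such that, for every $i$, $\mu^{(i)}$ is the law of the vector (number of letters $1$, ..., number of letters $K$) of a word with law $\zeta^{(i)}$, and such that, for every $i$, the Bienaymé–Galton–Watson plane tree whose root has type $i$, and in which, independently for all vertices, the sequence of types of the children of a vertex of type $j$ has law $\zeta^{(j)}$, is finite with positive probability; - nondegenerate: there is $i\in[K]$ with $\mu^{(i)}\big(\{k:\sum_{j}k_j\ge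 2\}\big)>0$; - nonlocalized: for every $X\in\mathbb{R}^K\setminus\{0\}$ there is $i\in[K]$ such that $\sum_{j}X_jk_j$ is not almost surely constant when $k$ has law $\mu^{(i)}$; - irreducible: for all $i,j\in[K]$ there is an integer $p\ge 1$ with $(M^p)_{i,j}>0$. Define $\chi:\mathbb{R}^K\to\mathbb{R}^K$ by $$\chi_i(\theta)=\log\phi^{(i)}(e^{\theta_1},\dots,e^{\theta_K})-\theta_i\qquad(i\in[K]).$$ Then the image $\mathcal{C}_{image}=\chi(\mathbb{R}^K)$ is a closed and convex subset of $\mathbb{R}^K$. -/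

import Mathlib

open scoped ENNReal

noncomputable section

namespace MultitypeBGW

/-- Finite words over the alphabet of `K` types, with the discrete σ-algebra. A word lists the types
of the children of a vertex, from left to right. -/
abbrev Word (K : ℕ) : Type := List (Fin K)

instance instMeasurableSpaceWord (K : ℕ) : MeasurableSpace (Word K) := ⊤

/-- The projection of a family of laws on words: `projection ζ i` is the law of
`(number of letters 1, …, number of letters K)` of a word with law `ζ i`. -/
def projection {K : ℕ} (ζ : Fin K → PMF (Word K)) : Fin K → PMF (Fin K → ℕ) :=
  fun i => (ζ i).map (fun w j => w.count j)

/-- Given words `x (u, j)` for all Ulam labels `u` and types `j`, `HasType x i u j` says that `u` is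
a vertex, of type `j`, of the plane tree with root type `i` in which a vertex `u` of type `j` has
the children `u0, …, u(n-1)`, `n` the length of the word `x (u, j)`, with types the successive
letters of that word (labels count children from `0`). -/
inductive HasType {K : ℕ} (x : List ℕ × Fin K → Word K) (i : Fin K) : List ℕ → Fin K → Prop
  | root : HasType x i [] i
  | child (u : List ℕ) (j : Fin K) (k : ℕ) (l : Fin K) :
      HasType x i u j → (x (u, j))[k]? = some l → HasType x i (u ++ [k]) l

/-- The vertex set of the tree with root type `i` built from the words `x`. -/
def tree {K : ℕ} (x : List ℕ × Fin K → Word K) (i : Fin K) : Set (List ℕ) :=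
  {u | ∃ j, HasType x i u j}

/-- The law of the independent words `X (u, j)`, with `X (u, j)` distributed according to `ζ j`. -/
def wordsLaw {K : ℕ} (ζ : Fin K → PMF (Word K)) :
    MeasureTheory.Measure (List ℕ × Fin K → Word K) :=
  MeasureTheory.Measure.infinitePi (fun p : List ℕ × Fin K => (ζ p.2).toMeasure)

/-- The probability that the `ζ`-BGW tree with root type `i` is finite. -/
def probFinite {K : ℕ} (ζ : Fin K → PMF (Word K)) (i : Fin K) : ℝ≥0∞ :=
  wordsLaw ζ {x | (tree x i).Finite}

/-- The general term of the generating series of a law on `ℕ ^ K`. -/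
def genTerm {K : ℕ} {𝕜 : Type*} [RCLike 𝕜] (ν : PMF (Fin K → ℕ)) (x : Fin K → 𝕜)
    (k : Fin K → ℕ) : 𝕜 :=
  ((ν k).toReal : 𝕜) * ∏ j, x j ^ k j

/-- The generating function of a law on `ℕ ^ K`. -/
def genFun {K : ℕ} {𝕜 : Type*} [RCLike 𝕜] (ν : PMF (Fin K → ℕ)) (x : Fin K → 𝕜) : 𝕜 :=
  ∑' k, genTerm ν x k

/-- The mean matrix: `meanMatrix μ i j` is the mean number (possibly `∞`) of children of type `j` of
a vertex of type `i`. -/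
def meanMatrix {K : ℕ} (μ : Fin K → PMF (Fin K → ℕ)) : Matrix (Fin K) (Fin K) ℝ≥0∞ :=
  Matrix.of fun i j => ∑' z : Fin K → ℕ, (z j : ℝ≥0∞) * μ i z

/-- Every generating series converges on `ℂ ^ K`, with a holomorphic sum. -/
def IsEntire {K : ℕ} (μ : Fin K → PMF (Fin K → ℕ)) : Prop :=
  ∀ i, (∀ z : Fin K → ℂ, Summable (genTerm (μ i) z)) ∧
    Differentiable ℂ (fun z : Fin K → ℂ => genFun (μ i) z)

/-- For every root type, the BGW tree is finite with positive probability. -/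
def IsFinite {K : ℕ} (μ : Fin K → PMF (Fin K → ℕ)) : Prop :=
  ∃ ζ : Fin K → PMF (Word K), projection ζ = μ ∧ ∀ i, 0 < probFinite ζ i

/-- Some type has at least two children with positive probability. -/
def IsNondegenerate {K : ℕ} (μ : Fin K → PMF (Fin K → ℕ)) : Prop :=
  ∃ i, 0 < (μ i).toMeasure {z : Fin K → ℕ | 2 ≤ ∑ j, z j}

/-- For every `X ≠ 0` there is a type `i` such that `∑ j, X j * k j` is not almost surely constant
when `k` has law `μ i`. -/
def IsNonlocalized {K : ℕ} (μ : Fin K → PMF (Fin K → ℕ)) : Prop :=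
  ∀ X : Fin K → ℝ, X ≠ 0 →
    ∃ i, ¬ ∃ c : ℝ, ∀ᵐ k ∂(μ i).toMeasure, ∑ j, X j * (k j : ℝ) = c

/-- The mean matrix is irreducible. -/
def IsIrreducible {K : ℕ} (μ : Fin K → PMF (Fin K → ℕ)) : Prop :=
  ∀ i j, ∃ p : ℕ, 0 < p ∧ 0 < (meanMatrix μ ^ p) i j

/-- `χ_i(θ) = log φ^{(i)}(e^{θ_1}, …, e^{θ_K}) - θ_i`. -/
def chi {K : ℕ} (μ : Fin K → PMF (Fin K → ℕ)) (θ : Fin K → ℝ) : Fin K → ℝ :=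
  fun i => Real.log (genFun (μ i) (fun j => Real.exp (θ j))) - θ i

/-- The image of `χ`. -/
def CImage {K : ℕ} (μ : Fin K → PMF (Fin K → ℕ)) : Set (Fin K → ℝ) :=
  Set.range (chi μ)

end MultitypeBGW

end

/-!
The point is that `χ` is a convex map whose image is an upper set. Write `F_i(θ) = log φ^{(i)}(e^θ)`,
so that `χ(θ) = F(θ) - θ`; `F` is monotone, convex (Hölder's inequality, `convexOn_chi`) and bounded
below by the affine functions `log μ^{(i)}(k) + ∑ k_j θ_j` with `k` in the support of `μ^{(i)}`
(`log_add_sum_le_chi`).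

Since the trees are finite with positive probability, every type is the root of some finite tree
all of whose offspring vectors are charged (`IsMortal`, `isMortal_of_probFinite_pos`). Following
such a tree from the leaves to the root, the affine lower bounds confine the sublevel set
`{θ | χ θ ≤ p}` to an orthant `{θ | c ≤ θ}` (`bddBelow_sublevel`). Hence a nonempty sublevel set has
an infimum, and by monotonicity of `F` this infimum solves `F θ = θ + p`, as in the Knaster-Tarski
theorem: the image of `χ` is an upper set (`isUpperSet_CImage`). As the image is the set of the `p`
that lie above some value of the convex map `χ`, it is convex.

For closedness, irreducibility makes the differences `θ_j - θ_i` bounded on a sublevel set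
(`exists_apply_le_apply_add`), and then an offspring vector with at least two children bounds the
coordinates from above (`bddAbove_sublevel`). So sublevel sets are bounded, the continuous map `χ`
is proper, and its image is closed.
-/

namespace MultitypeBGW

/-! ### Generating functions at real points -/

section GenFun

variable {K : ℕ} {ν : PMF (Fin K → ℕ)}

lemma genTerm_ofReal (ν : PMF (Fin K → ℕ)) (x : Fin K → ℝ) (k : Fin K → ℕ) :
    genTerm ν (fun j => (x j : ℂ)) k = ((genTerm ν x k : ℝ) : ℂ) := by
  simp [genTerm]

lemma genFun_ofReal (ν : PMF (Fin K → ℕ)) (x : Fin K → ℝ) :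
    genFun ν (fun j => (x j : ℂ)) = ((genFun ν x : ℝ) : ℂ) := by
  simp only [genFun, genTerm_ofReal, Complex.ofReal_tsum]

lemma summable_genTerm_real (h : ∀ z : Fin K → ℂ, Summable (genTerm ν z)) (x : Fin K → ℝ) :
    Summable (genTerm ν x) := by
  have := h (fun j => (x j : ℂ))
  rw [funext (genTerm_ofReal ν x)] at this
  exact Complex.summable_ofReal.1 this

lemma continuous_genFun_real (h : Differentiable ℂ (fun z : Fin K → ℂ => genFun ν z)) :
    Continuous (fun x : Fin K → ℝ => genFun ν x) := by
  have : (fun x : Fin K → ℝ => genFun ν x) =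
      fun x : Fin K → ℝ => (genFun ν (fun j => (x j : ℂ))).re := by
    funext x
    rw [genFun_ofReal, Complex.ofReal_re]
  rw [this]
  exact Complex.continuous_re.comp (h.continuous.comp (by fun_prop))

lemma genTerm_exp (ν : PMF (Fin K → ℕ)) (θ : Fin K → ℝ) (k : Fin K → ℕ) :
    genTerm ν (fun j => Real.exp (θ j)) k = (ν k).toReal * Real.exp (∑ j, (k j : ℝ) * θ j) := by
  simp only [genTerm, Real.exp_sum, Real.exp_nat_mul]
  rfl

lemma genTerm_exp_nonneg (ν : PMF (Fin K → ℕ)) (θ : Fin K → ℝ) (k : Fin K → ℕ) :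
    0 ≤ genTerm ν (fun j => Real.exp (θ j)) k := by
  rw [genTerm_exp]
  positivity

lemma toReal_pos_of_ne_zero {k : Fin K → ℕ} (hk : ν k ≠ 0) : 0 < (ν k).toReal :=
  ENNReal.toReal_pos hk (ν.apply_ne_top k)

lemma le_genFun_exp (hs : ∀ x : Fin K → ℝ, Summable (genTerm ν x)) (θ : Fin K → ℝ)
    (k : Fin K → ℕ) :
    (ν k).toReal * Real.exp (∑ j, (k j : ℝ) * θ j) ≤ genFun ν (fun j => Real.exp (θ j)) := by
  rw [← genTerm_exp]
  exact (hs _).le_tsum k fun j _ => genTerm_exp_nonneg ν θ j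

lemma genFun_exp_pos (hs : ∀ x : Fin K → ℝ, Summable (genTerm ν x)) (θ : Fin K → ℝ) :
    0 < genFun ν (fun j => Real.exp (θ j)) := by
  obtain ⟨k, hk⟩ := ν.support_nonempty
  have := toReal_pos_of_ne_zero ((ν.mem_support_iff k).1 hk)
  exact lt_of_lt_of_le (by positivity) (le_genFun_exp hs θ k)

lemma genFun_exp_mono (hs : ∀ x : Fin K → ℝ, Summable (genTerm ν x)) {θ θ' : Fin K → ℝ}
    (h : θ ≤ θ') :
    genFun ν (fun j => Real.exp (θ j)) ≤ genFun ν (fun j => Real.exp (θ' j)) := by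
  refine (hs _).tsum_le_tsum (fun k => ?_) (hs _)
  rw [genTerm_exp, genTerm_exp]
  gcongr with j
  exact h j

lemma genFun_exp_le_rpow_mul_rpow (hs : ∀ x : Fin K → ℝ, Summable (genTerm ν x))
    (θ θ' : Fin K → ℝ) {a b : ℝ} (ha : 0 < a) (hb : 0 < b) (hab : a + b = 1) :
    genFun ν (fun j => Real.exp ((a • θ + b • θ') j)) ≤
      genFun ν (fun j => Real.exp (θ j)) ^ a * genFun ν (fun j => Real.exp (θ' j)) ^ b := by
  have hpq : (a⁻¹).HolderConjugate b⁻¹ := Real.HolderConjugate.inv_inv ha hb hab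
  have key : ∀ k, genTerm ν (fun j => Real.exp ((a • θ + b • θ') j)) k =
      genTerm ν (fun j => Real.exp (θ j)) k ^ a * genTerm ν (fun j => Real.exp (θ' j)) k ^ b := by
    intro k
    rw [genTerm_exp, genTerm_exp, genTerm_exp, Real.mul_rpow (by positivity) (by positivity),
      Real.mul_rpow (by positivity) (by positivity), ← Real.exp_mul, ← Real.exp_mul,
      mul_mul_mul_comm, ← Real.exp_add, ← Real.rpow_add_of_nonneg (by positivity) ha.le hb.le, hab,
      Real.rpow_one]
    congr 2
    rw [Finset.sum_mul, Finset.sum_mul, ← Finset.sum_add_distrib]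
    refine Finset.sum_congr rfl fun j _ => ?_
    simp only [Pi.add_apply, Pi.smul_apply, smul_eq_mul]
    ring
  have e : ∀ (η : Fin K → ℝ) (k : Fin K → ℕ) (c : ℝ), 0 < c →
      (genTerm ν (fun j => Real.exp (η j)) k ^ c) ^ c⁻¹ =
        genTerm ν (fun j => Real.exp (η j)) k := fun η k c hc =>
    Real.rpow_rpow_inv (genTerm_exp_nonneg ν η k) hc.ne'
  have := Real.inner_le_Lp_mul_Lq_tsum_of_nonneg hpq
    (f := fun k => genTerm ν (fun j => Real.exp (θ j)) k ^ a)
    (g := fun k => genTerm ν (fun j => Real.exp (θ' j)) k ^ b)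
    (fun k => Real.rpow_nonneg (genTerm_exp_nonneg ν θ k) _)
    (fun k => Real.rpow_nonneg (genTerm_exp_nonneg ν θ' k) _)
    (by simpa only [e θ _ a ha] using hs _) (by simpa only [e θ' _ b hb] using hs _)
  simpa only [genFun, key, e θ _ a ha, e θ' _ b hb, one_div, inv_inv] using this

end GenFun

/-! ### The map `χ` -/

section Chi

variable {K : ℕ} {μ : Fin K → PMF (Fin K → ℕ)}

lemma continuous_chi (hent : IsEntire μ) : Continuous (chi μ) := by
  refine continuous_pi fun i => ?_
  have hc : Continuous fun θ : Fin K → ℝ => genFun (μ i) (fun j => Real.exp (θ j)) :=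
    (continuous_genFun_real (hent i).2).comp (by fun_prop)
  exact (hc.log fun θ => (genFun_exp_pos (summable_genTerm_real (hent i).1) θ).ne').sub
    (continuous_apply i)

lemma convexOn_chi (hent : IsEntire μ) (i : Fin K) :
    ConvexOn ℝ Set.univ (fun θ => chi μ θ i) := by
  refine convexOn_iff_forall_pos.2 ⟨convex_univ, fun θ _ θ' _ a b ha hb hab => ?_⟩
  have hs := summable_genTerm_real (hent i).1
  have hθ := genFun_exp_pos hs θ
  have hθ' := genFun_exp_pos hs θ'
  have h := Real.log_le_log (genFun_exp_pos hs _)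
    (genFun_exp_le_rpow_mul_rpow hs θ θ' ha hb hab)
  rw [Real.log_mul (by positivity) (by positivity), Real.log_rpow hθ, Real.log_rpow hθ'] at h
  simp only [chi, smul_eq_mul, Pi.add_apply, Pi.smul_apply] at h ⊢
  linarith

/-- A term of the generating series with positive coefficient bounds `χ` below by an affine
function. -/
lemma log_add_sum_le_chi (hent : IsEntire μ) {i : Fin K} {k : Fin K → ℕ} (hk : μ i k ≠ 0)
    (θ : Fin K → ℝ) :
    Real.log (μ i k).toReal + ∑ j, (k j : ℝ) * θ j ≤ chi μ θ i + θ i := by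
  have hs := summable_genTerm_real (hent i).1
  have hpos := toReal_pos_of_ne_zero hk
  have h := Real.log_le_log (by positivity) (le_genFun_exp hs θ k)
  rw [Real.log_mul hpos.ne' (Real.exp_ne_zero _), Real.log_exp] at h
  simpa [chi] using h

lemma chi_add_le_chi_add (hent : IsEntire μ) {θ θ' : Fin K → ℝ} (h : θ ≤ θ') (i : Fin K) :
    chi μ θ i + θ i ≤ chi μ θ' i + θ' i := by
  have hs := summable_genTerm_real (hent i).1
  simpa [chi] using Real.log_le_log (genFun_exp_pos hs θ) (genFun_exp_mono hs h)

end Chi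

/-! ### Extinction -/

section Mortal

variable {K : ℕ}

/-- Type `i` is mortal if it is the root type of some finite tree in which the offspring vector of
every vertex has positive probability: some charged offspring vector of `i` has only mortal types. -/
inductive IsMortal (μ : Fin K → PMF (Fin K → ℕ)) : Fin K → Prop
  | intro (i : Fin K) (k : Fin K → ℕ) :
      μ i k ≠ 0 → (∀ j, k j ≠ 0 → IsMortal μ j) → IsMortal μ i

/-- Below a vertex whose type is not mortal, one of the children is again of nonmortal type. -/
lemma exists_child_not_isMortal {ζ : Fin K → PMF (Word K)} {x : List ℕ × Fin K → Word K}
    (hx : ∀ p, ζ p.2 (x p) ≠ 0) {i j : Fin K} {u : List ℕ} (hu : HasType x i u j)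
    (hj : ¬ IsMortal (projection ζ) j) :
    ∃ k l, HasType x i (u ++ [k]) l ∧ ¬ IsMortal (projection ζ) l := by
  have hk : projection ζ j (fun l => (x (u, j)).count l) ≠ 0 := by
    rw [← PMF.mem_support_iff, projection, PMF.support_map]
    exact ⟨x (u, j), hx (u, j), rfl⟩
  by_contra! hcon
  refine hj (IsMortal.intro j _ hk fun l hl => ?_)
  obtain ⟨k, hk⟩ := List.mem_iff_getElem?.1 (List.count_pos_iff.1 (Nat.pos_of_ne_zero hl))
  exact hcon k l (HasType.child u j k l hu hk)

lemma not_finite_tree {ζ : Fin K → PMF (Word K)} {x : List ℕ × Fin K → Word K}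
    (hx : ∀ p, ζ p.2 (x p) ≠ 0) {i : Fin K} (hi : ¬ IsMortal (projection ζ) i) :
    ¬ (tree x i).Finite := by
  have h : ∀ n : ℕ, ∃ u j, u.length = n ∧ HasType x i u j ∧ ¬ IsMortal (projection ζ) j := by
    intro n
    induction n with
    | zero => exact ⟨[], i, rfl, HasType.root, hi⟩
    | succ n ih =>
      obtain ⟨u, j, hun, hu, hj⟩ := ih
      obtain ⟨k, l, hkl, hl⟩ := exists_child_not_isMortal hx hu hj
      exact ⟨u ++ [k], l, by simp [hun], hkl, hl⟩
  intro hf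
  refine Set.infinite_univ ((hf.image List.length).subset fun n _ => ?_)
  obtain ⟨u, j, hun, hu, -⟩ := h n
  exact ⟨u, ⟨j, hu⟩, hun⟩

lemma ae_wordsLaw_ne_zero (ζ : Fin K → PMF (Word K)) :
    ∀ᵐ x ∂(wordsLaw ζ), ∀ p, ζ p.2 (x p) ≠ 0 := by
  refine MeasureTheory.ae_all_iff.2 fun p => ?_
  have hmp := measurePreserving_eval_infinitePi
    (fun p : List ℕ × Fin K => (ζ p.2).toMeasure) p
  refine hmp.quasiMeasurePreserving.ae (p := fun w => ζ p.2 w ≠ 0) ?_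
  rw [MeasureTheory.ae_iff, PMF.toMeasure_apply_eq_zero_iff _ (MeasurableSpace.measurableSet_top), Set.disjoint_left]
  intro w hw hw'
  exact hw' ((PMF.mem_support_iff _ _).1 hw)

lemma isMortal_of_probFinite_pos {ζ : Fin K → PMF (Word K)} {i : Fin K}
    (h : 0 < probFinite ζ i) : IsMortal (projection ζ) i := by
  by_contra hi
  have hnull : wordsLaw ζ {x | (tree x i).Finite} = 0 :=
    MeasureTheory.measure_mono_null (fun x hx hx' => not_finite_tree hx' hi hx)
      (MeasureTheory.ae_iff.1 (ae_wordsLaw_ne_zero ζ))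
  exact h.ne' hnull

end Mortal

/-! ### Sublevel sets of `χ` -/

section Sublevel

variable {K : ℕ} {μ : Fin K → PMF (Fin K → ℕ)}

lemma IsMortal.exists_le_apply (hent : IsEntire μ) (p : Fin K → ℝ) {i : Fin K}
    (hi : IsMortal μ i) : ∃ c : ℝ, ∀ θ, chi μ θ ≤ p → c ≤ θ i := by
  induction hi with
  | intro i k hk _ ih =>
    choose! c hc using ih
    refine ⟨Real.log (μ i k).toReal + ∑ j, (k j : ℝ) * c j - p i, fun θ hθ => ?_⟩
    have h1 := log_add_sum_le_chi hent hk θ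
    have h2 : ∑ j, (k j : ℝ) * c j ≤ ∑ j, (k j : ℝ) * θ j := by
      refine Finset.sum_le_sum fun j _ => ?_
      by_cases hj : k j = 0
      · simp [hj]
      · exact mul_le_mul_of_nonneg_left (hc j hj θ hθ) (Nat.cast_nonneg _)
    linarith [hθ i]

lemma bddBelow_sublevel (hent : IsEntire μ) (hfin : IsFinite μ) (p : Fin K → ℝ) :
    BddBelow {θ | chi μ θ ≤ p} := by
  obtain ⟨ζ, rfl, hζ⟩ := hfin
  choose c hc using fun i => (isMortal_of_probFinite_pos (hζ i)).exists_le_apply hent p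
  exact ⟨c, fun θ hθ i => hc i θ hθ⟩

/-- The infimum of a sublevel set `{θ | F θ ≤ θ + p}` is a fixed point of the monotone map
`θ ↦ F θ - p`. -/
lemma isUpperSet_CImage (hent : IsEntire μ) (hfin : IsFinite μ) : IsUpperSet (CImage μ) := by
  rintro _ p hp ⟨θ₀, rfl⟩
  set S : Set (Fin K → ℝ) := {θ | chi μ θ ≤ p}
  have hglb : IsGLB S (sInf S) := isGLB_csInf ⟨θ₀, hp⟩ (bddBelow_sublevel hent hfin p)
  set m := sInf S
  set m' : Fin K → ℝ := fun i => chi μ m i + m i - p i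
  have hm' : ∀ i, m' i = chi μ m i + m i - p i := fun _ => rfl
  have hle : m' ≤ m := hglb.2 fun θ hθ i => by
    have h1 := chi_add_le_chi_add hent (hglb.1 hθ) i
    have h2 : chi μ θ i ≤ p i := hθ i
    linarith [hm' i]
  have hmem : m' ∈ S := fun i => by
    linarith [chi_add_le_chi_add hent hle i, hm' i]
  exact ⟨m, funext fun i => by linarith [hle i, hglb.1 hmem i, hm' i]⟩

lemma exists_ne_zero_of_meanMatrix_ne_zero {i j : Fin K} (h : meanMatrix μ i j ≠ 0) :
    ∃ k : Fin K → ℕ, k j ≠ 0 ∧ μ i k ≠ 0 := by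
  by_contra! hcon
  refine h (ENNReal.tsum_eq_zero.2 fun k => ?_)
  by_cases hk : k j = 0
  · simp [hk]
  · simp [hcon k hk]

/-- On a sublevel set, the coordinate of a type exceeds that of its possible parents by at most a
constant. -/
lemma exists_apply_le_apply_add_of_ne_zero (hent : IsEntire μ) (hfin : IsFinite μ)
    (p : Fin K → ℝ) {i j : Fin K} {k : Fin K → ℕ} (hj : k j ≠ 0) (hk : μ i k ≠ 0) :
    ∃ D : ℝ, ∀ θ, chi μ θ ≤ p → θ j ≤ θ i + D := by
  obtain ⟨c, hc⟩ := bddBelow_sublevel hent hfin p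
  refine ⟨p i - Real.log (μ i k).toReal - ∑ l, (k l : ℝ) * c l + c j, fun θ hθ => ?_⟩
  have h1 := log_add_sum_le_chi hent hk θ
  have hcθ : ∀ l, 0 ≤ θ l - c l := fun l => sub_nonneg.2 (hc hθ l)
  have h2 : (k j : ℝ) * (θ j - c j) ≤ ∑ l, (k l : ℝ) * (θ l - c l) :=
    Finset.single_le_sum (f := fun l => (k l : ℝ) * (θ l - c l))
      (fun l _ => mul_nonneg (Nat.cast_nonneg _) (hcθ l)) (Finset.mem_univ j)
  have h3 : θ j - c j ≤ (k j : ℝ) * (θ j - c j) :=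
    le_mul_of_one_le_left (hcθ j) (by exact_mod_cast Nat.one_le_iff_ne_zero.2 hj)
  simp only [mul_sub, Finset.sum_sub_distrib] at h2 h3
  linarith [hθ i]

lemma exists_apply_le_apply_add_of_pow_ne_zero (hent : IsEntire μ) (hfin : IsFinite μ)
    (p : Fin K → ℝ) (n : ℕ) (i j : Fin K) (h : (meanMatrix μ ^ n) i j ≠ 0) :
    ∃ D : ℝ, ∀ θ, chi μ θ ≤ p → θ j ≤ θ i + D := by
  induction n generalizing j with
  | zero =>
    obtain rfl : i = j := by
      by_contra hij
      simp [Matrix.one_apply_ne hij] at h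
    exact ⟨0, fun θ _ => by simp⟩
  | succ n ih =>
    rw [pow_succ, Matrix.mul_apply] at h
    obtain ⟨l, -, hl⟩ := Finset.exists_ne_zero_of_sum_ne_zero h
    obtain ⟨D, hD⟩ := ih l (left_ne_zero_of_mul hl)
    obtain ⟨k, hkj, hk⟩ := exists_ne_zero_of_meanMatrix_ne_zero (right_ne_zero_of_mul hl)
    obtain ⟨D', hD'⟩ := exists_apply_le_apply_add_of_ne_zero hent hfin p hkj hk
    exact ⟨D + D', fun θ hθ => by linarith [hD θ hθ, hD' θ hθ]⟩

lemma exists_apply_le_apply_add (hent : IsEntire μ) (hfin : IsFinite μ) (hirr : IsIrreducible μ)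
    (p : Fin K → ℝ) (i j : Fin K) : ∃ D : ℝ, ∀ θ, chi μ θ ≤ p → θ j ≤ θ i + D := by
  obtain ⟨n, -, hn⟩ := hirr i j
  exact exists_apply_le_apply_add_of_pow_ne_zero hent hfin p n i j hn.ne'

lemma IsNondegenerate.exists_ne_zero (hnd : IsNondegenerate μ) :
    ∃ i, ∃ k : Fin K → ℕ, μ i k ≠ 0 ∧ 2 ≤ ∑ j, k j := by
  obtain ⟨i, hi⟩ := hnd
  by_contra! hcon
  refine hi.ne' ((PMF.toMeasure_apply_eq_zero_iff _ (Set.to_countable _).measurableSet).2 ?_)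
  rw [Set.disjoint_left]
  intro k hk hk'
  exact absurd hk' (not_le.2 (hcon i k ((PMF.mem_support_iff _ _).1 hk)))

lemma bddAbove_sublevel (hent : IsEntire μ) (hfin : IsFinite μ) (hnd : IsNondegenerate μ)
    (hirr : IsIrreducible μ) (p : Fin K → ℝ) : BddAbove {θ | chi μ θ ≤ p} := by
  obtain ⟨i, k, hk, hk2⟩ := hnd.exists_ne_zero
  choose D hD using fun j => exists_apply_le_apply_add hent hfin hirr p j i
  choose D' hD' using fun j => exists_apply_le_apply_add hent hfin hirr p i j
  set B : ℝ := p i - Real.log (μ i k).toReal + ∑ j, (k j : ℝ) * D j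
  have hB : ∀ θ, chi μ θ ≤ p → θ i ≤ max 0 B := by
    intro θ hθ
    have h1 := log_add_sum_le_chi hent hk θ
    have h2 : ∑ j, (k j : ℝ) * (θ i - D j) ≤ ∑ j, (k j : ℝ) * θ j :=
      Finset.sum_le_sum fun j _ =>
        mul_le_mul_of_nonneg_left (by linarith [hD j θ hθ]) (Nat.cast_nonneg _)
    simp only [mul_sub, Finset.sum_sub_distrib, ← Finset.sum_mul] at h2
    have hk2' : (2 : ℝ) ≤ ∑ j, (k j : ℝ) := by exact_mod_cast hk2
    rcases le_total (θ i) 0 with h0 | h0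
    · exact h0.trans (le_max_left _ _)
    -- the affine bound has slope at least `2` along the diagonal, against slope `1` of `θ i`
    · refine le_trans ?_ (le_max_right _ _)
      have h3 := mul_le_mul_of_nonneg_right hk2' h0
      linarith [hθ i]
  exact ⟨fun j => max 0 B + D' j, fun θ hθ j => by
    change θ j ≤ max 0 B + D' j
    linarith [hD' j θ hθ, hB θ hθ]⟩

end Sublevel

/-! ### The image of `χ` -/

section Image

variable {K : ℕ} {μ : Fin K → PMF (Fin K → ℕ)}

lemma convex_CImage (hent : IsEntire μ) (hfin : IsFinite μ) : Convex ℝ (CImage μ) := by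
  rintro _ ⟨θ, rfl⟩ _ ⟨θ', rfl⟩ a b ha hb hab
  exact isUpperSet_CImage hent hfin
    (fun i => (convexOn_chi hent i).2 (Set.mem_univ θ) (Set.mem_univ θ') ha hb hab)
    ⟨a • θ + b • θ', rfl⟩

lemma isClosed_CImage (hent : IsEntire μ) (hfin : IsFinite μ) (hnd : IsNondegenerate μ)
    (hirr : IsIrreducible μ) : IsClosed (CImage μ) := by
  have hproper : IsProperMap (chi μ) := by
    refine isProperMap_iff_isCompact_preimage.2 ⟨continuous_chi hent, fun s hs => ?_⟩
    obtain ⟨p, hp⟩ := hs.isBounded.bddAbove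
    have hb : Bornology.IsBounded {θ | chi μ θ ≤ p} :=
      isBounded_iff_bddBelow_bddAbove.2
        ⟨bddBelow_sublevel hent hfin p, bddAbove_sublevel hent hfin hnd hirr p⟩
    exact Metric.isCompact_of_isClosed_isBounded (hs.isClosed.preimage (continuous_chi hent))
      (hb.subset fun θ hθ => hp hθ)
  exact hproper.isClosedMap.isClosed_range

end Image

end MultitypeBGW

theorem mainTheorem6 (K : ℕ) (μ : Fin K → PMF (Fin K → ℕ))
    (hent : MultitypeBGW.IsEntire μ) (hfin : MultitypeBGW.IsFinite μ)
    (hnd : MultitypeBGW.IsNondegenerate μ) (hnl : MultitypeBGW.IsNonlocalized μ)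
    (hirr : MultitypeBGW.IsIrreducible μ) :
    IsClosed (MultitypeBGW.CImage μ) ∧ Convex ℝ (MultitypeBGW.CImage μ) :=
  ⟨MultitypeBGW.isClosed_CImage hent hfin hnd hirr, MultitypeBGW.convex_CImage hent hfin⟩
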